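/- For a finite simple graph $G$, let $P_3(G)$ denote its third power: the graph on the same vertex set in which two distinct vertices are adjacent if and only if their distance in $G$ is at most $3$. Let $K_p$ be the complete graph on $p$ vertices. (i) A finite tree $T$ is determined up to isomorphism by $P_3(T)$, provided $P_3(T)$ is not a complete graph: if $T$ and $T'$ are finite trees such that $P_3(T)\not\cong K_p$ for every $p$ and $P_3(T)\cong P_3(T')$, then $T\cong T'$. (ii) For a finite tree $T$ and a natural number $p$, $P_3(T)\cong K_p$ if and only if $T$ has exactly $p$ vertices and diameter less than $4$. (iii) Consequently uniqueness fails for complete graphs: for every $p\ge 4$ there are non-isomorphic trees $T_1,T_2$ on $p$ vertices with $P_3(T_1)\cong P_3(T_2)\cong K_p$. -/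

import Mathlib

universe u v

/-- The `k`-th power `P_k(G)` of a simple graph `G`: the graph on the same vertices in which two
distinct vertices are adjacent iff their distance in `G` is at most `k`. The extended distance is
used, so that vertices in different components of `G` are at distance `⊤` and never adjacent. -/
def SimpleGraph.distPower {V : Type*} (G : SimpleGraph V) (k : ℕ) : SimpleGraph V where
  Adj u v := u ≠ v ∧ G.edist u v ≤ (k : ℕ∞)
  symm := ⟨fun _ _ h => ⟨h.1.symm, by rw [SimpleGraph.edist_comm]; exact h.2⟩⟩
  loopless := ⟨fun _ h => h.1 rfl⟩

/-! If a tree has diameter at least 4, the maximal cliques of its cube are exactly the double stars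
N[u] ∪ N[v] on edges whose ends are both inner, that is, not leaves (`IsTree.maximal_isClique_iff`).
Two distinct double stars share three vertices only when their edges meet in a vertex m, and then
they intersect in N[m]. So the cube determines the sets N[m] for m core
(`IsTree.cliqueMeets_distPower`). A pendant vertex has a single inner neighbour, which is core, and
its leaves are what remains of the double star on that edge (`IsTree.cliqueTails_distPower`).

Inner vertices are thus labelled by sets read off from the cube. Their adjacency and the number of
leaves at each are also determined (`IsTree.adj_of_corr`, `IsTree.ncard_leafSet_eq`). Leaves at the
same vertex are interchangeable, so this fixes the tree up to isomorphism, though not as a labelled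
graph.

The cube is complete exactly when all distances are at most 3. A star, and a star with one leaf
re-hung on another, show that such trees are not unique. -/

namespace SimpleGraph

/-! ### Distances in trees; inner, core and pendant vertices. -/

section Basic

variable {V : Type*} {T : SimpleGraph V}

/-- A vertex with at least two neighbours. -/
def Inner (T : SimpleGraph V) (v : V) : Prop := ∃ a b, a ≠ b ∧ T.Adj v a ∧ T.Adj v b

/-- A vertex with at least two neighbours that are themselves inner vertices. -/
def Core (T : SimpleGraph V) (v : V) : Prop :=
  ∃ a b, a ≠ b ∧ T.Adj v a ∧ T.Adj v b ∧ T.Inner a ∧ T.Inner b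

/-- An inner vertex that is not a core vertex. -/
def Pendant (T : SimpleGraph V) (v : V) : Prop := T.Inner v ∧ ¬ T.Core v

/-- The neighbours of `v` that are not inner vertices. -/
def leafSet (T : SimpleGraph V) (v : V) : Set V := {x | T.Adj v x ∧ ¬ T.Inner x}

/-- The closed neighbourhood of `v`. -/
def closedNbhd (T : SimpleGraph V) (v : V) : Set V := insert v (T.neighborSet v)

lemma mem_leafSet {v x : V} : x ∈ T.leafSet v ↔ T.Adj v x ∧ ¬ T.Inner x := Iff.rfl

lemma mem_closedNbhd {v x : V} : x ∈ T.closedNbhd v ↔ x = v ∨ T.Adj v x := Iff.rfl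

lemma Core.inner {v : V} (h : T.Core v) : T.Inner v := by
  obtain ⟨a, b, hab, ha, hb, -, -⟩ := h
  exact ⟨a, b, hab, ha, hb⟩

lemma Inner.exists_adj_ne {v : V} (h : T.Inner v) (w : V) : ∃ a, a ≠ w ∧ T.Adj v a := by
  obtain ⟨a, b, hab, ha, hb⟩ := h
  by_cases haw : a = w
  · exact ⟨b, fun hbw => hab (haw.trans hbw.symm), hb⟩
  · exact ⟨a, haw, ha⟩

lemma eq_of_adj_of_not_inner {x a b : V} (hx : ¬ T.Inner x) (ha : T.Adj x a) (hb : T.Adj x b) :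
    a = b := by
  by_contra h
  exact hx ⟨a, b, h, ha, hb⟩

lemma Connected.exists_adj_dist_add_one (hT : T.Connected) {x z : V} (h : x ≠ z) :
    ∃ a, T.Adj x a ∧ T.dist z x = T.dist z a + 1 := by
  obtain ⟨p, hp⟩ := hT.exists_walk_length_eq_dist x z
  cases p with
  | nil => exact absurd rfl h
  | cons hadj q =>
    rename_i a
    refine ⟨a, hadj, ?_⟩
    have h1 := T.dist_le q
    have h2 := hT.dist_triangle (u := x) (v := a) (w := z)
    rw [dist_eq_one_iff_adj.2 hadj] at h2
    rw [Walk.length_cons] at hp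
    rw [dist_comm (u := z) (v := x), dist_comm (u := z) (v := a)]
    omega

/-- A shortest walk from either neighbour to z extends to a shortest walk from m, hence to a path,
and paths in a tree are unique. So a distance function has no local maximum in the interior of a
path; most later arguments use this form. -/
lemma IsTree.eq_of_dist_lt (hT : T.IsTree) {z m u v : V} (hu : T.Adj m u) (hv : T.Adj m v)
    (h1 : T.dist z u < T.dist z m) (h2 : T.dist z v < T.dist z m) : u = v := by
  have key : ∀ w, T.Adj m w → T.dist z w < T.dist z m →
      ∃ p : T.Walk m z, p.IsPath ∧ p.snd = w := by
    intro w hw hlt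
    obtain ⟨q, hq⟩ := hT.1.exists_walk_length_eq_dist w z
    refine ⟨Walk.cons hw q, Walk.isPath_of_length_eq_dist _ ?_, by simp⟩
    have := T.dist_le (Walk.cons hw q)
    rw [Walk.length_cons] at this ⊢
    rw [dist_comm (u := m)] at *
    rw [dist_comm (u := w)] at *
    omega
  obtain ⟨p, hp, rfl⟩ := key u hu h1
  obtain ⟨q, hq, rfl⟩ := key v hv h2
  rw [(hT.existsUnique_path m z).unique hp hq]

lemma IsTree.eq_of_adj_adj (hT : T.IsTree) {x y a b : V} (hxy : x ≠ y) (hax : T.Adj a x)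
    (hay : T.Adj a y) (hbx : T.Adj b x) (hby : T.Adj b y) : a = b := by
  by_contra hab
  have h1 := dist_eq_one_iff_adj.2 hax
  have h2 := dist_eq_one_iff_adj.2 hay
  have h3 := hT.dist_eq_dist_add_one_of_adj a hbx
  have h4 := hT.1.pos_dist_of_ne hab
  exact hxy (hT.eq_of_dist_lt hbx hby (z := a) (by omega)
    (by have := hT.dist_eq_dist_add_one_of_adj a hby; omega))

lemma IsTree.not_adj_of_adj_adj (hT : T.IsTree) {a x y : V} (hx : T.Adj a x) (hy : T.Adj a y) :
    ¬ T.Adj x y := by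
  intro h
  have h1 := dist_eq_one_iff_adj.2 hx
  have h2 := dist_eq_one_iff_adj.2 hy
  have := hT.dist_eq_dist_add_one_of_adj a h
  omega

lemma IsTree.distPower_adj (hT : T.IsTree) {k : ℕ} {x y : V} :
    (T.distPower k).Adj x y ↔ x ≠ y ∧ T.dist x y ≤ k := by
  change x ≠ y ∧ T.edist x y ≤ k ↔ _
  rw [← (hT.1 x y).coe_dist_eq_edist, Nat.cast_le]

lemma dist_le_one_of_mem_closedNbhd {x v : V}
    (h : x ∈ T.closedNbhd v) : T.dist v x ≤ 1 := by
  rcases h with rfl | h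
  · simp
  · exact (dist_eq_one_iff_adj.2 h).le

lemma Connected.mem_closedNbhd_of_dist_le_one (hT : T.Connected) {x v : V}
    (h : T.dist v x ≤ 1) : x ∈ T.closedNbhd v := by
  rcases Nat.le_one_iff_eq_zero_or_eq_one.1 h with h | h
  · exact Or.inl (hT.dist_eq_zero_iff.1 h).symm
  · exact Or.inr (dist_eq_one_iff_adj.1 h)

lemma Connected.dist_le_three (hT : T.Connected) {u v x y : V} (huv : T.Adj u v)
    (hx : x ∈ T.closedNbhd u ∪ T.closedNbhd v) (hy : y ∈ T.closedNbhd u ∪ T.closedNbhd v) :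
    T.dist x y ≤ 3 := by
  have h1 := dist_eq_one_iff_adj.2 huv
  have key : ∀ a b, (a = b ∨ T.dist a b = 1) → x ∈ T.closedNbhd a → y ∈ T.closedNbhd b →
      T.dist x y ≤ 3 := by
    intro a b hab hx hy
    have hx := dist_le_one_of_mem_closedNbhd hx
    have hy := dist_le_one_of_mem_closedNbhd hy
    have h2 := hT.dist_triangle (u := x) (v := a) (w := y)
    have h3 := hT.dist_triangle (u := a) (v := b) (w := y)
    rw [dist_comm (u := a) (v := x)] at hx
    have h4 : T.dist a b ≤ 1 := by
      rcases hab with rfl | h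
      · simp
      · exact h.le
    omega
  rcases hx with hx | hx <;> rcases hy with hy | hy
  · exact key u u (Or.inl rfl) hx hy
  · exact key u v (Or.inr h1) hx hy
  · exact key v u (Or.inr (by rw [dist_comm]; exact h1)) hx hy
  · exact key v v (Or.inl rfl) hx hy

/-- The first vertex on the way to a vertex at distance at least two is inner. -/
lemma Connected.exists_inner_adj (hT : T.Connected) {v z : V} (h : 2 ≤ T.dist z v) :
    ∃ a, T.Adj v a ∧ T.Inner a ∧ T.dist z v = T.dist z a + 1 := by
  have hvz : v ≠ z := by rintro rfl; simp at h
  obtain ⟨a, ha, hd⟩ := hT.exists_adj_dist_add_one hvz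
  have haz : a ≠ z := by
    rintro rfl
    rw [dist_self] at hd
    omega
  obtain ⟨b, hb, hd'⟩ := hT.exists_adj_dist_add_one haz
  exact ⟨a, ha, ⟨v, b, by rintro rfl; omega, ha.symm, hb⟩, hd⟩

lemma Connected.exists_two_le_dist (hT : T.Connected) (h : ∃ x y, 4 ≤ T.dist x y) (v : V) :
    ∃ z, 2 ≤ T.dist z v := by
  obtain ⟨x, y, h⟩ := h
  by_contra! hv
  have h1 := hv x
  have h2 := hv y
  have := hT.dist_triangle (u := x) (v := v) (w := y)
  rw [dist_comm (u := v) (v := y)] at this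
  omega

lemma Connected.exists_adj_inner (hT : T.Connected) (h : ∃ x y, 4 ≤ T.dist x y) (v : V) :
    ∃ a, T.Adj v a ∧ T.Inner a := by
  obtain ⟨z, hz⟩ := hT.exists_two_le_dist h v
  obtain ⟨a, ha, hi, -⟩ := hT.exists_inner_adj hz
  exact ⟨a, ha, hi⟩

/-- Two vertices that are both inner but not core are never adjacent. -/
lemma IsTree.not_adj_of_pendant (hT : T.IsTree) (h : ∃ x y, 4 ≤ T.dist x y) {v w : V}
    (hv : T.Pendant v) (hw : T.Pendant w) : ¬ T.Adj v w := by
  intro hvw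
  -- A vertex z far away on the side of v would give v a second inner neighbour besides w, making v
  -- core. Hence the whole tree lies in the double star on vw and has diameter at most 3.
  have key : ∀ v w z, T.Pendant v → T.Inner w → T.Adj v w → T.dist z w = T.dist z v + 1 →
      T.dist z v ≤ 1 := by
    intro v w z hv hw hvw hz
    by_contra! h2
    obtain ⟨a, ha, hi, hd⟩ := hT.1.exists_inner_adj h2
    exact hv.2 ⟨a, w, by rintro rfl; omega, ha, hvw, hi, hw⟩
  obtain ⟨x, y, hxy⟩ := h
  have hmem : ∀ z, z ∈ T.closedNbhd v ∪ T.closedNbhd w := by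
    intro z
    rcases hT.dist_eq_dist_add_one_of_adj z hvw with hz | hz
    · have := key w v z hw hv.1 hvw.symm hz
      rw [dist_comm] at this
      exact Or.inr (hT.1.mem_closedNbhd_of_dist_le_one this)
    · have := key v w z hv hw.1 hvw hz
      rw [dist_comm] at this
      exact Or.inl (hT.1.mem_closedNbhd_of_dist_le_one this)
  have := hT.1.dist_le_three hvw (hmem x) (hmem y)
  omega

end Basic

/-! ### Maximal cliques of the cube. -/

section Cliques

variable {V : Type*} {T : SimpleGraph V}

/-- Two vertices at distance two in the double star on an edge have one of its centres as their
midpoint. -/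
lemma IsTree.eq_or_eq_of_mem_union (hT : T.IsTree) {m x y u v : V} (hxy : x ≠ y)
    (hmx : T.Adj m x) (hmy : T.Adj m y) (huv : T.Adj u v)
    (hx : x ∈ T.closedNbhd u ∪ T.closedNbhd v) (hy : y ∈ T.closedNbhd u ∪ T.closedNbhd v) :
    m = u ∨ m = v := by
  have key : ∀ u v, T.Adj u v → x ∈ T.closedNbhd u → y ∈ T.closedNbhd u ∪ T.closedNbhd v →
      m = u ∨ m = v := by
    rintro u v huv (rfl | hx) ((rfl | hy) | (rfl | hy))
    · exact absurd rfl hxy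
    · exact absurd hy (hT.not_adj_of_adj_adj hmx hmy)
    · exact absurd huv (hT.not_adj_of_adj_adj hmx hmy)
    · exact Or.inr (hT.eq_of_adj_adj hxy hmx hmy huv.symm hy)
    · exact absurd hx.symm (hT.not_adj_of_adj_adj hmx hmy)
    · exact Or.inl (hT.eq_of_adj_adj hxy hmx hmy hx hy)
    · exact Or.inl (hT.eq_of_adj_adj hxy hmx hmy hx huv)
    -- If m is neither centre, both u and v are at distance 2 from m, but distances from m to
    -- adjacent vertices differ by one.
    · by_contra! h
      have h1 := dist_eq_one_iff_adj.2 hmx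
      have h2 := dist_eq_one_iff_adj.2 hmy
      have h3 := hT.1.pos_dist_of_ne h.1
      have h4 := hT.1.pos_dist_of_ne h.2
      have h5 := hT.dist_eq_dist_add_one_of_adj m hx
      have h6 := hT.dist_eq_dist_add_one_of_adj m hy
      have h7 := hT.dist_eq_dist_add_one_of_adj m huv
      omega
  rcases hx with hx | hx
  · exact key u v huv hx hy
  · exact (key v u huv.symm hx (Or.symm hy)).symm

lemma IsTree.dist_eq_two (hT : T.IsTree) {x a b : V} (hxa : T.Adj x a) (hab : T.Adj a b)
    (hxb : x ≠ b) : T.dist x b = 2 := by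
  have h1 := dist_eq_one_iff_adj.2 hxa
  have h2 := hT.dist_eq_dist_add_one_of_adj x hab
  have h3 := hT.1.pos_dist_of_ne hxb
  omega

lemma IsTree.dist_eq_three (hT : T.IsTree) {x a b y : V} (hxa : T.Adj x a) (hab : T.Adj a b)
    (hby : T.Adj b y) (hxb : x ≠ b) (hay : a ≠ y) : T.dist x y = 3 := by
  have h1 := dist_eq_one_iff_adj.2 hxa
  have h2 := hT.dist_eq_two hxa hab hxb
  rcases hT.dist_eq_dist_add_one_of_adj x hby with h3 | h3
  · exact absurd (hT.eq_of_dist_lt (z := x) hab.symm hby (by omega) (by omega)) hay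
  · omega

/-- Two vertices at distance three determine the edge whose double star contains both. -/
lemma IsTree.eq_and_eq_of_mem_union (hT : T.IsTree) {x a b y u v : V} (hxa : T.Adj x a)
    (hab : T.Adj a b) (hby : T.Adj b y) (hxb : x ≠ b) (hay : a ≠ y) (huv : T.Adj u v)
    (hx : x ∈ T.closedNbhd u ∪ T.closedNbhd v) (hy : y ∈ T.closedNbhd u ∪ T.closedNbhd v) :
    (u = a ∧ v = b) ∨ (u = b ∧ v = a) := by
  have hd := hT.dist_eq_three hxa hab hby hxb hay
  have hne : ∀ w, x ∈ T.closedNbhd w → y ∉ T.closedNbhd w := by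
    intro w h1 h2
    have h1 := dist_le_one_of_mem_closedNbhd h1
    have h2 := dist_le_one_of_mem_closedNbhd h2
    have h3 := hT.1.dist_triangle (u := x) (v := w) (w := y)
    rw [dist_comm (u := w) (v := x)] at h1
    omega
  have key : ∀ u v, T.Adj u v → x ∈ T.closedNbhd u → y ∈ T.closedNbhd v → u = a ∧ v = b := by
    intro u v huv hx hy
    have hx1 := dist_le_one_of_mem_closedNbhd hx
    have hy1 := dist_le_one_of_mem_closedNbhd hy
    have huv1 := dist_eq_one_iff_adj.2 huv
    have h3 := hT.1.dist_triangle (u := x) (v := u) (w := y)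
    have h4 := hT.1.dist_triangle (u := u) (v := v) (w := y)
    have h5 := hT.1.dist_triangle (u := x) (v := v) (w := y)
    have h6 := hT.1.dist_triangle (u := x) (v := u) (w := v)
    have h7 := dist_eq_one_iff_adj.2 hxa
    have h8 := dist_eq_one_iff_adj.2 hby
    have h9 := hT.1.dist_triangle (u := x) (v := a) (w := y)
    have h10 := hT.1.dist_triangle (u := a) (v := b) (w := y)
    have h11 := dist_eq_one_iff_adj.2 hab
    have h12 := hT.1.dist_triangle (u := x) (v := b) (w := y)
    have h13 := hT.1.dist_triangle (u := x) (v := a) (w := b)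
    rw [dist_comm (u := u) (v := x)] at hx1
    have hux : T.Adj x u := dist_eq_one_iff_adj.1 (by omega)
    have hvy : T.Adj y v := by
      rw [← dist_eq_one_iff_adj, dist_comm]; omega
    constructor
    · refine hT.eq_of_dist_lt (z := y) hux hxa ?_ ?_ <;>
        rw [dist_comm (u := y), dist_comm (u := y)] <;> omega
    · exact hT.eq_of_dist_lt (z := x) hvy hby.symm (by omega) (by omega)
  rcases hx with hx | hx <;> rcases hy with hy | hy
  · exact absurd hy (hne u hx)
  · exact Or.inl (key u v huv hx hy)
  · exact Or.inr (key v u huv.symm hx hy).symm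
  · exact absurd hy (hne v hx)

/-- Because both ends are inner, the double star contains two vertices at distance 3, and these
determine the edge. -/
lemma IsTree.edge_unique (hT : T.IsTree) {u v u' v' : V} (hu : T.Inner u) (hv : T.Inner v)
    (huv : T.Adj u v) (huv' : T.Adj u' v')
    (h : T.closedNbhd u ∪ T.closedNbhd v ⊆ T.closedNbhd u' ∪ T.closedNbhd v') :
    (u' = u ∧ v' = v) ∨ (u' = v ∧ v' = u) := by
  obtain ⟨x, hx, hux⟩ := hu.exists_adj_ne v
  obtain ⟨y, hy, hvy⟩ := hv.exists_adj_ne u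
  exact hT.eq_and_eq_of_mem_union hux.symm huv hvy hx hy.symm huv'
    (h (Or.inl (Or.inr hux))) (h (Or.inr (Or.inr hvy)))

/-- A set of pairwise distance at most three lies in the double star on some inner edge. -/
lemma IsTree.exists_subset_union (hT : T.IsTree) (hbig : ∃ x y, 4 ≤ T.dist x y) {K : Set V}
    (hK : ∀ x ∈ K, ∀ y ∈ K, T.dist x y ≤ 3) :
    ∃ u v, T.Inner u ∧ T.Inner v ∧ T.Adj u v ∧ K ⊆ T.closedNbhd u ∪ T.closedNbhd v := by
  -- A single closed neighbourhood of an inner vertex is enough, as every vertex has an inner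
  -- neighbour. The proof then splits on the largest distance attained in K.
  suffices h : ∃ u v, T.Inner u ∧ (T.Inner v ∧ T.Adj u v ∧
      K ⊆ T.closedNbhd u ∪ T.closedNbhd v ∨ K ⊆ T.closedNbhd u) by
    obtain ⟨u, v, hu, ⟨hv, huv, h⟩ | h⟩ := h
    · exact ⟨u, v, hu, hv, huv, h⟩
    · obtain ⟨w, hw, hwi⟩ := hT.1.exists_adj_inner hbig u
      exact ⟨u, w, hu, hwi, hw, h.trans Set.subset_union_left⟩
  by_cases h3 : ∃ x ∈ K, ∃ y ∈ K, T.dist x y = 3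
  · obtain ⟨x, hx, y, hy, hxy⟩ := h3
    obtain ⟨a, hxa, hda⟩ := hT.1.exists_adj_dist_add_one (x := x) (z := y)
      (by rintro rfl; simp at hxy)
    rw [dist_comm, hxy] at hda
    obtain ⟨b, hab, hdb⟩ := hT.1.exists_adj_dist_add_one (x := a) (z := y)
      (by rintro rfl; rw [dist_self] at hda; omega)
    have hby : T.Adj b y := by rw [← dist_eq_one_iff_adj, dist_comm]; omega
    have hxb : x ≠ b := by rintro rfl; rw [dist_comm (u := y) (v := x)] at hdb; omega
    have hay : a ≠ y := by rintro rfl; rw [dist_self] at hda; omega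
    refine ⟨a, b, ⟨x, b, hxb, hxa.symm, hab⟩, Or.inl ⟨⟨a, y, hay, hab.symm, hby⟩, hab, ?_⟩⟩
    intro z hz
    have hzx := hK z hz x hx
    have hzy := hK z hz y hy
    have h1 := hT.dist_eq_dist_add_one_of_adj z hxa
    have h2 := hT.dist_eq_dist_add_one_of_adj z hab
    have h3 := hT.dist_eq_dist_add_one_of_adj z hby
    -- Along x, a, b, y the distance to z changes by one at each step and has no interior peak.
    -- Being at most 3 at both ends, it drops to at most 1 at a or b.
    have h4 : ¬ (T.dist z x < T.dist z a ∧ T.dist z b < T.dist z a) :=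
      fun h => hxb (hT.eq_of_dist_lt hxa.symm hab h.1 h.2)
    have h5 : ¬ (T.dist z a < T.dist z b ∧ T.dist z y < T.dist z b) :=
      fun h => hay (hT.eq_of_dist_lt hab.symm hby h.1 h.2)
    have : T.dist z a ≤ 1 ∨ T.dist z b ≤ 1 := by omega
    rw [dist_comm (u := z) (v := a), dist_comm (u := z) (v := b)] at this
    exact this.imp hT.1.mem_closedNbhd_of_dist_le_one hT.1.mem_closedNbhd_of_dist_le_one
  have hK2 : ∀ x ∈ K, ∀ y ∈ K, T.dist x y ≤ 2 := by
    intro x hx y hy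
    have := hK x hx y hy
    have : T.dist x y ≠ 3 := fun h => h3 ⟨x, hx, y, hy, h⟩
    omega
  by_cases h2 : ∃ x ∈ K, ∃ y ∈ K, T.dist x y = 2
  · obtain ⟨x, hx, y, hy, hxy⟩ := h2
    obtain ⟨a, hxa, hda⟩ := hT.1.exists_adj_dist_add_one (x := x) (z := y)
      (by rintro rfl; simp at hxy)
    rw [dist_comm, hxy] at hda
    have hay : T.Adj a y := by rw [← dist_eq_one_iff_adj, dist_comm]; omega
    have hxy' : x ≠ y := by rintro rfl; simp at hxy
    refine ⟨a, a, ⟨x, y, hxy', hxa.symm, hay⟩, Or.inr ?_⟩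
    intro z hz
    have hzx := hK2 z hz x hx
    have hzy := hK2 z hz y hy
    have h1 := hT.dist_eq_dist_add_one_of_adj z hxa
    have h3 := hT.dist_eq_dist_add_one_of_adj z hay
    have h4 : ¬ (T.dist z x < T.dist z a ∧ T.dist z y < T.dist z a) :=
      fun h => hxy' (hT.eq_of_dist_lt hxa.symm hay h.1 h.2)
    refine hT.1.mem_closedNbhd_of_dist_le_one ?_
    rw [dist_comm]
    omega
  have hK1 : ∀ x ∈ K, ∀ y ∈ K, y ∈ T.closedNbhd x := by
    intro x hx y hy
    have := hK2 x hx y hy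
    have : T.dist x y ≠ 2 := fun h => h2 ⟨x, hx, y, hy, h⟩
    exact hT.1.mem_closedNbhd_of_dist_le_one (by omega)
  rcases K.eq_empty_or_nonempty with rfl | ⟨x, hx⟩
  · obtain ⟨z, -⟩ := id hbig
    obtain ⟨a, -, hi⟩ := hT.1.exists_adj_inner hbig z
    exact ⟨a, a, hi, Or.inr (Set.empty_subset _)⟩
  · by_cases hxi : T.Inner x
    · exact ⟨x, x, hxi, Or.inr fun y hy => hK1 x hx y hy⟩
    · obtain ⟨a, hxa, hi⟩ := hT.1.exists_adj_inner hbig x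
      refine ⟨a, a, hi, Or.inr fun y hy => ?_⟩
      rcases hK1 x hx y hy with rfl | h
      · exact Or.inr hxa.symm
      · exact Or.inl (eq_of_adj_of_not_inner hxi h hxa)

lemma IsTree.isClique_distPower (hT : T.IsTree) {k : ℕ} {K : Set V} :
    (T.distPower k).IsClique K ↔ ∀ x ∈ K, ∀ y ∈ K, T.dist x y ≤ k := by
  constructor
  · intro h x hx y hy
    by_cases hxy : x = y
    · simp [hxy]
    · exact (hT.distPower_adj.1 (h hx hy hxy)).2
  · intro h x hx y hy hxy
    exact hT.distPower_adj.2 ⟨hxy, h x hx y hy⟩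

/-- The maximal cliques of the cube of a tree are the double stars on its inner edges. -/
lemma IsTree.maximal_isClique_iff (hT : T.IsTree) (hbig : ∃ x y, 4 ≤ T.dist x y) {K : Set V} :
    Maximal (T.distPower 3).IsClique K ↔
      ∃ u v, T.Inner u ∧ T.Inner v ∧ T.Adj u v ∧ K = T.closedNbhd u ∪ T.closedNbhd v := by
  have hcl : ∀ u v, T.Adj u v → (T.distPower 3).IsClique (T.closedNbhd u ∪ T.closedNbhd v) :=
    fun u v huv => hT.isClique_distPower.2 fun x hx y hy => hT.1.dist_le_three huv hx hy
  constructor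
  · intro h
    obtain ⟨u, v, hu, hv, huv, hs⟩ := hT.exists_subset_union hbig (hT.isClique_distPower.1 h.1)
    exact ⟨u, v, hu, hv, huv, hs.antisymm (h.2 (hcl u v huv) hs)⟩
  · rintro ⟨u, v, hu, hv, huv, rfl⟩
    refine ⟨hcl u v huv, fun K hK hs => ?_⟩
    obtain ⟨u', v', -, -, huv', hs'⟩ := hT.exists_subset_union hbig (hT.isClique_distPower.1 hK)
    rcases hT.edge_unique hu hv huv huv' (hs.trans hs') with ⟨rfl, rfl⟩ | ⟨rfl, rfl⟩
    · exact hs'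
    · rwa [Set.union_comm] at hs'

end Cliques

/-! ### Reading neighbourhoods and leaf sets off the cube. -/

section Canonical

variable {V : Type*}

/-- The intersections of two maximal cliques that have at least three elements. -/
def cliqueMeets (G : SimpleGraph V) : Set (Set V) :=
  {N | ∃ C C', Maximal G.IsClique C ∧ Maximal G.IsClique C' ∧ C ≠ C' ∧
    (∃ x y z, x ≠ y ∧ x ≠ z ∧ y ≠ z ∧ x ∈ C ∩ C' ∧ y ∈ C ∩ C' ∧ z ∈ C ∩ C') ∧ N = C ∩ C'}

/-- The remainders of the maximal cliques that contain exactly one member of `cliqueMeets`. -/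
def cliqueTails (G : SimpleGraph V) : Set (Set V) :=
  {L | ∃ C N, Maximal G.IsClique C ∧ N ∈ G.cliqueMeets ∧ N ⊆ C ∧
    (∀ N' ∈ G.cliqueMeets, N' ⊆ C → N' = N) ∧ L = C \ N}

variable {T : SimpleGraph V}

lemma IsTree.union_inter_union (hT : T.IsTree) {m u w : V} (hu : T.Adj m u) (hw : T.Adj m w)
    (huw : u ≠ w) :
    (T.closedNbhd m ∪ T.closedNbhd u) ∩ (T.closedNbhd m ∪ T.closedNbhd w) = T.closedNbhd m := by
  rw [← Set.union_inter_distrib_left, Set.union_eq_left]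
  rintro x ⟨rfl | h1, rfl | h2⟩
  · exact absurd rfl huw
  · exact absurd h2.symm (hT.not_adj_of_adj_adj hu hw)
  · exact absurd h1 (hT.not_adj_of_adj_adj hu hw)
  · exact Or.inl (hT.eq_of_adj_adj huw h1.symm h2.symm hu hw)

/-- Three common vertices include a non-adjacent pair, since a tree has no triangle. The midpoint of
that pair, or the middle edge of its path, then lies on both edges carrying the cliques. -/
lemma IsTree.cliqueMeets_distPower (hT : T.IsTree) (hbig : ∃ x y, 4 ≤ T.dist x y) {N : Set V} :
    N ∈ (T.distPower 3).cliqueMeets ↔ ∃ m, T.Core m ∧ N = T.closedNbhd m := by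
  constructor
  · rintro ⟨C, C', hC, hC', hne, ⟨x, y, z, hxy, hxz, hyz, hx, hy, hz⟩, rfl⟩
    obtain ⟨u, v, hu, hv, huv, rfl⟩ := (hT.maximal_isClique_iff hbig).1 hC
    obtain ⟨u', v', hu', hv', huv', rfl⟩ := (hT.maximal_isClique_iff hbig).1 hC'
    obtain ⟨m, hm, hm'⟩ : ∃ m, (m = u ∨ m = v) ∧ (m = u' ∨ m = v') := by
      have key : ∀ x y, x ≠ y → ¬ T.Adj x y →
          x ∈ (T.closedNbhd u ∪ T.closedNbhd v) ∩ (T.closedNbhd u' ∪ T.closedNbhd v') →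
          y ∈ (T.closedNbhd u ∪ T.closedNbhd v) ∩ (T.closedNbhd u' ∪ T.closedNbhd v') →
          ∃ m, (m = u ∨ m = v) ∧ (m = u' ∨ m = v') := by
        intro x y hxy hadj hx hy
        have h3 := hT.1.dist_le_three huv hx.1 hy.1
        have h1 := hT.1.one_lt_dist_of_ne_of_not_adj hxy hadj
        obtain ⟨a, hxa, hda⟩ := hT.1.exists_adj_dist_add_one hxy
        rw [dist_comm (u := y) (v := x)] at hda
        by_cases hay : T.Adj a y
        · exact ⟨a, hT.eq_or_eq_of_mem_union hxy hxa.symm hay huv hx.1 hy.1,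
            hT.eq_or_eq_of_mem_union hxy hxa.symm hay huv' hx.2 hy.2⟩
        have hne' : a ≠ y := by rintro rfl; rw [dist_self] at hda; omega
        have h1' := hT.1.one_lt_dist_of_ne_of_not_adj hne' hay
        rw [dist_comm (u := a) (v := y)] at h1'
        obtain ⟨b, hab, hdb⟩ := hT.1.exists_adj_dist_add_one hne'
        have hby : T.Adj b y := by rw [← dist_eq_one_iff_adj, dist_comm]; omega
        have hxb : x ≠ b := by rintro rfl; rw [dist_comm (u := y) (v := x)] at hdb; omega
        have e1 := hT.eq_and_eq_of_mem_union hxa hab hby hxb hne' huv hx.1 hy.1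
        have e2 := hT.eq_and_eq_of_mem_union hxa hab hby hxb hne' huv' hx.2 hy.2
        exact ⟨a, by tauto, by tauto⟩
      by_cases h1 : T.Adj x y
      · by_cases h2 : T.Adj x z
        · exact key y z hyz (hT.not_adj_of_adj_adj h1 h2) hy hz
        · exact key x z hxz h2 hx hz
      · exact key x y hxy h1 hx hy
    obtain ⟨a, hma, hai, hmi, ha⟩ : ∃ a, T.Adj m a ∧ T.Inner a ∧ T.Inner m ∧
        T.closedNbhd u ∪ T.closedNbhd v = T.closedNbhd m ∪ T.closedNbhd a := by
      rcases hm with rfl | rfl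
      · exact ⟨v, huv, hv, hu, rfl⟩
      · exact ⟨u, huv.symm, hu, hv, Set.union_comm _ _⟩
    obtain ⟨b, hmb, hbi, hb⟩ : ∃ b, T.Adj m b ∧ T.Inner b ∧
        T.closedNbhd u' ∪ T.closedNbhd v' = T.closedNbhd m ∪ T.closedNbhd b := by
      rcases hm' with rfl | rfl
      · exact ⟨v', huv', hv', rfl⟩
      · exact ⟨u', huv'.symm, hu', Set.union_comm _ _⟩
    have hab : a ≠ b := by
      rintro rfl
      exact hne (ha.trans hb.symm)
    exact ⟨m, ⟨a, b, hab, hma, hmb, hai, hbi⟩, by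
      rw [ha, hb, hT.union_inter_union hma hmb hab]⟩
  · rintro ⟨m, hm, rfl⟩
    have hmi := hm.inner
    obtain ⟨a, b, hab, ha, hb, hai, hbi⟩ := hm
    refine ⟨_, _, (hT.maximal_isClique_iff hbig).2 ⟨m, a, hmi, hai, ha, rfl⟩,
      (hT.maximal_isClique_iff hbig).2 ⟨m, b, hmi, hbi, hb, rfl⟩, ?_, ?_,
      (hT.union_inter_union ha hb hab).symm⟩
    · intro h
      rcases hT.edge_unique hmi hai ha hb h.le with ⟨-, h⟩ | ⟨h, -⟩
      · exact hab h.symm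
      · exact ha.ne h
    · rw [hT.union_inter_union ha hb hab]
      exact ⟨m, a, b, ha.ne, hb.ne, hab, Or.inl rfl, Or.inr ha, Or.inr hb⟩

lemma IsTree.eq_or_eq_of_closedNbhd_subset (hT : T.IsTree) {w u v : V} (hw : T.Inner w)
    (huv : T.Adj u v) (h : T.closedNbhd w ⊆ T.closedNbhd u ∪ T.closedNbhd v) :
    w = u ∨ w = v := by
  obtain ⟨a, b, hab, ha, hb⟩ := hw
  exact hT.eq_or_eq_of_mem_union hab ha hb huv (h (Or.inr ha)) (h (Or.inr hb))

lemma IsTree.closedNbhd_injOn (hT : T.IsTree) {v w : V} (hv : T.Inner v)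
    (h : T.closedNbhd v = T.closedNbhd w) : v = w := by
  obtain ⟨a, b, hab, ha, hb⟩ := hv
  rcases h.subset (Or.inr ha) with rfl | ha'
  · rcases h.subset (Or.inr hb) with rfl | hb'
    · exact absurd rfl hab
    · exact absurd hb' (hT.not_adj_of_adj_adj ha hb)
  · rcases h.subset (Or.inr hb) with rfl | hb'
    · exact absurd ha'.symm (hT.not_adj_of_adj_adj ha hb)
    · exact hT.eq_of_adj_adj hab ha hb ha' hb'

lemma Pendant.mem_leafSet_iff {v w x : V} (hv : T.Pendant v) (hvw : T.Adj v w)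
    (hw : T.Inner w) : x ∈ T.leafSet v ↔ T.Adj v x ∧ x ≠ w := by
  refine ⟨fun h => ⟨h.1, fun e => h.2 (e ▸ hw)⟩, fun h => ⟨h.1, fun hx => hv.2 ?_⟩⟩
  exact ⟨x, w, h.2, h.1, hvw, hx, hw⟩

lemma IsTree.union_diff_eq_leafSet (hT : T.IsTree) {v w : V} (hv : T.Pendant v)
    (hvw : T.Adj v w) (hw : T.Inner w) :
    (T.closedNbhd w ∪ T.closedNbhd v) \ T.closedNbhd w = T.leafSet v := by
  ext x
  rw [hv.mem_leafSet_iff hvw hw]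
  constructor
  · rintro ⟨h | rfl | h, hx⟩
    · exact absurd h hx
    · exact absurd (Or.inr hvw.symm) hx
    · exact ⟨h, fun e => hx (Or.inl e)⟩
  · rintro ⟨h, hx⟩
    refine ⟨Or.inr (Or.inr h), ?_⟩
    rintro (h' | h')
    · exact hx h'
    · exact absurd h' (hT.not_adj_of_adj_adj hvw h)

lemma IsTree.core_of_adj_pendant (hT : T.IsTree) (hbig : ∃ x y, 4 ≤ T.dist x y) {v w : V}
    (hv : T.Pendant v) (hvw : T.Adj v w) (hw : T.Inner w) : T.Core w := by
  by_contra h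
  exact hT.not_adj_of_pendant hbig hv ⟨hw, h⟩ hvw

/-- A double star contains N[m] for an inner m only if m is one of its centres. So exactly one meet
lies inside it when exactly one centre is core; the other centre is then pendant, and removing the
meet leaves its leaves. -/
lemma IsTree.cliqueTails_distPower (hT : T.IsTree) (hbig : ∃ x y, 4 ≤ T.dist x y) {L : Set V} :
    L ∈ (T.distPower 3).cliqueTails ↔ ∃ v, T.Pendant v ∧ L = T.leafSet v := by
  constructor
  · rintro ⟨C, N, hC, hN, hNC, huniq, rfl⟩
    obtain ⟨w, hw, rfl⟩ := (hT.cliqueMeets_distPower hbig).1 hN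
    obtain ⟨u, v, hu, hv, huv, rfl⟩ := (hT.maximal_isClique_iff hbig).1 hC
    have key : ∀ v, T.Inner v → T.Adj w v →
        (∀ N' ∈ (T.distPower 3).cliqueMeets, N' ⊆ T.closedNbhd w ∪ T.closedNbhd v →
          N' = T.closedNbhd w) →
        ∃ v', T.Pendant v' ∧
          (T.closedNbhd w ∪ T.closedNbhd v) \ T.closedNbhd w = T.leafSet v' := by
      intro v hv hwv huniq
      have hp : T.Pendant v := by
        refine ⟨hv, fun hc => hwv.ne ?_⟩
        exact (hT.closedNbhd_injOn hv (huniq _ ((hT.cliqueMeets_distPower hbig).2 ⟨v, hc, rfl⟩)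
          Set.subset_union_right)).symm
      exact ⟨v, hp, hT.union_diff_eq_leafSet hp hwv.symm hw.inner⟩
    rcases hT.eq_or_eq_of_closedNbhd_subset hw.inner huv hNC with rfl | rfl
    · exact key v hv huv huniq
    · rw [Set.union_comm] at huniq ⊢
      exact key u hu huv.symm huniq
  · rintro ⟨v, hv, rfl⟩
    obtain ⟨w, hvw, hw⟩ := hT.1.exists_adj_inner hbig v
    have hc := hT.core_of_adj_pendant hbig hv hvw hw
    refine ⟨_, _, (hT.maximal_isClique_iff hbig).2 ⟨w, v, hw, hv.1, hvw.symm, rfl⟩,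
      (hT.cliqueMeets_distPower hbig).2 ⟨w, hc, rfl⟩, Set.subset_union_left, ?_,
      (hT.union_diff_eq_leafSet hv hvw hw).symm⟩
    intro N' hN' hs
    obtain ⟨m, hm, rfl⟩ := (hT.cliqueMeets_distPower hbig).1 hN'
    rcases hT.eq_or_eq_of_closedNbhd_subset hm.inner hvw.symm hs with rfl | rfl
    · rfl
    · exact absurd hm hv.2

lemma IsTree.leafSet_nonempty (hT : T.IsTree) (hbig : ∃ x y, 4 ≤ T.dist x y) {v : V}
    (hv : T.Pendant v) : (T.leafSet v).Nonempty := by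
  obtain ⟨w, hvw, hw⟩ := hT.1.exists_adj_inner hbig v
  obtain ⟨x, hx, hvx⟩ := hv.1.exists_adj_ne w
  exact ⟨x, (hv.mem_leafSet_iff hvw hw).2 ⟨hvx, hx⟩⟩

lemma IsTree.leafSet_injOn (hT : T.IsTree) (hbig : ∃ x y, 4 ≤ T.dist x y) {v w : V}
    (hv : T.Pendant v) (h : T.leafSet v = T.leafSet w) : v = w := by
  obtain ⟨x, hx⟩ := hT.leafSet_nonempty hbig hv
  exact eq_of_adj_of_not_inner hx.2 hx.1.symm (h.subset hx).1.symm

lemma IsTree.adj_iff_exists_mem_closedNbhd (hT : T.IsTree) {v w : V} (hvw : v ≠ w) :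
    T.Adj v w ↔ ∃ x y, x ≠ y ∧ x ∈ T.closedNbhd v ∩ T.closedNbhd w ∧
      y ∈ T.closedNbhd v ∩ T.closedNbhd w := by
  constructor
  · intro h
    exact ⟨v, w, hvw, ⟨Or.inl rfl, Or.inr h.symm⟩, ⟨Or.inr h, Or.inl rfl⟩⟩
  · rintro ⟨x, y, hxy, hx, hy⟩
    by_contra hadj
    have key : ∀ x, x ∈ T.closedNbhd v ∩ T.closedNbhd w → T.Adj v x ∧ T.Adj w x := by
      rintro x ⟨rfl | h1, h2 | h2⟩
      · exact absurd h2 hvw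
      · exact absurd h2.symm hadj
      · exact absurd (h2 ▸ h1) hadj
      · exact ⟨h1, h2⟩
    exact hvw (hT.eq_of_adj_adj hxy (key x hx).1 (key y hy).1 (key x hx).2 (key y hy).2)

/-- For the converse, take a leaf x at v and a neighbour y of w pointing away from v. Then x and y
are at distance d(v, w) + 2, and the bound 3 forces d(v, w) = 1. -/
lemma IsTree.adj_pendant_iff (hT : T.IsTree) (hbig : ∃ x y, 4 ≤ T.dist x y) {v w : V}
    (hv : T.Pendant v) (hw : T.Core w) :
    T.Adj v w ↔ ∀ x ∈ T.leafSet v, ∀ y ∈ T.closedNbhd w, x = y ∨ (T.distPower 3).Adj x y := by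
  constructor
  · intro h x hx y hy
    by_cases hxy : x = y
    · exact Or.inl hxy
    · exact Or.inr (hT.distPower_adj.2
        ⟨hxy, hT.1.dist_le_three h (Or.inl (Or.inr hx.1)) (Or.inr hy)⟩)
  · intro h
    obtain ⟨x, hx⟩ := hT.leafSet_nonempty hbig hv
    have hvw : v ≠ w := by rintro rfl; exact hv.2 hw
    obtain ⟨a, b, hab, ha, hb⟩ := hw.inner
    obtain ⟨y, hwy, hdy⟩ : ∃ y, T.Adj w y ∧ T.dist v y = T.dist v w + 1 := by
      rcases hT.dist_eq_dist_add_one_of_adj v ha with h1 | h1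
      · rcases hT.dist_eq_dist_add_one_of_adj v hb with h2 | h2
        · exact absurd (hT.eq_of_dist_lt (z := v) ha hb (by omega) (by omega)) hab
        · exact ⟨b, hb, h2⟩
      · exact ⟨a, ha, h1⟩
    have hpos := hT.1.pos_dist_of_ne hvw
    have hxy : x ≠ y := by
      rintro rfl
      rw [dist_eq_one_iff_adj.2 hx.1] at hdy
      omega
    obtain ⟨c, hxc, hdc⟩ := hT.1.exists_adj_dist_add_one hxy
    obtain rfl : c = v := eq_of_adj_of_not_inner hx.2 hxc hx.1.symm
    have h3 : T.dist x y ≤ 3 := by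
      rcases h x hx y (Or.inr hwy) with h | h
      · exact absurd h hxy
      · exact (hT.distPower_adj.1 h).2
    rw [dist_comm, dist_comm (u := y)] at hdc
    exact dist_eq_one_iff_adj.1 (by omega)

end Canonical

/-! ### Matching two trees with the same cube. -/

section Correspondence

variable {V : Type*} {T T' : SimpleGraph V}

/-- Inner vertices of two trees that have the same traces among the cliques of a common cube. -/
def Corr (T T' : SimpleGraph V) (v v' : V) : Prop :=
  (T.Core v ∧ T'.Core v' ∧ T.closedNbhd v = T'.closedNbhd v') ∨
    (T.Pendant v ∧ T'.Pendant v' ∧ T.leafSet v = T'.leafSet v')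

lemma Corr.symm {v v' : V} (h : Corr T T' v v') : Corr T' T v' v :=
  h.imp (fun h => ⟨h.2.1, h.1, h.2.2.symm⟩) (fun h => ⟨h.2.1, h.1, h.2.2.symm⟩)

lemma Corr.inner {v v' : V} (h : Corr T T' v v') : T.Inner v :=
  h.elim (fun h => h.1.inner) (fun h => h.1.1)

lemma IsTree.exists_corr (hT : T.IsTree) (hT' : T'.IsTree) (hb : ∃ x y, 4 ≤ T.dist x y)
    (hb' : ∃ x y, 4 ≤ T'.dist x y) (hG : T.distPower 3 = T'.distPower 3) {v : V}
    (hv : T.Inner v) : ∃ v', Corr T T' v v' := by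
  by_cases hc : T.Core v
  · have h := (hT.cliqueMeets_distPower hb).2 ⟨v, hc, rfl⟩
    rw [hG] at h
    obtain ⟨v', hv', h⟩ := (hT'.cliqueMeets_distPower hb').1 h
    exact ⟨v', Or.inl ⟨hc, hv', h⟩⟩
  · have h := (hT.cliqueTails_distPower hb).2 ⟨v, ⟨hv, hc⟩, rfl⟩
    rw [hG] at h
    obtain ⟨v', hv', h⟩ := (hT'.cliqueTails_distPower hb').1 h
    exact ⟨v', Or.inr ⟨⟨hv, hc⟩, hv', h⟩⟩

lemma IsTree.corr_unique (hT' : T'.IsTree) (hb' : ∃ x y, 4 ≤ T'.dist x y) {v v₁ v₂ : V}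
    (h₁ : Corr T T' v v₁) (h₂ : Corr T T' v v₂) : v₁ = v₂ := by
  rcases h₁ with h₁ | h₁ <;> rcases h₂ with h₂ | h₂
  · exact hT'.closedNbhd_injOn h₁.2.1.inner (h₁.2.2.symm.trans h₂.2.2)
  · exact absurd h₁.1 h₂.1.2
  · exact absurd h₂.1 h₁.1.2
  · exact hT'.leafSet_injOn hb' h₁.2.1 (h₁.2.2.symm.trans h₂.2.2)

lemma IsTree.adj_of_corr (hT : T.IsTree) (hT' : T'.IsTree) (hb : ∃ x y, 4 ≤ T.dist x y)
    (hb' : ∃ x y, 4 ≤ T'.dist x y) (hG : T.distPower 3 = T'.distPower 3) {v v' w w' : V}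
    (hv : Corr T T' v v') (hw : Corr T T' w w') (h : T.Adj v w) : T'.Adj v' w' := by
  have hne : v' ≠ w' := by
    rintro rfl
    exact h.ne (hT.corr_unique hb hv.symm hw.symm)
  rcases hv with ⟨hv, hv', e⟩ | ⟨hv, hv', e⟩ <;> rcases hw with ⟨hw, hw', f⟩ | ⟨hw, hw', f⟩
  · rw [hT'.adj_iff_exists_mem_closedNbhd hne, ← e, ← f]
    exact (hT.adj_iff_exists_mem_closedNbhd h.ne).1 h
  · refine SimpleGraph.Adj.symm ((hT'.adj_pendant_iff hb' hw' hv').2 ?_)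
    rw [← e, ← f, ← hG]
    exact (hT.adj_pendant_iff hb hw hv).1 h.symm
  · rw [hT'.adj_pendant_iff hb' hv' hw', ← e, ← f, ← hG]
    exact (hT.adj_pendant_iff hb hv hw).1 h
  · exact absurd h (hT.not_adj_of_pendant hb hv hw)

lemma ncard_closedNbhd [Finite V] (v : V) :
    (T.closedNbhd v).ncard = {x | T.Adj v x ∧ T.Inner x}.ncard + (T.leafSet v).ncard + 1 := by
  have h : T.neighborSet v = {x | T.Adj v x ∧ T.Inner x} ∪ T.leafSet v := by
    ext x
    simp only [mem_neighborSet, Set.mem_union, Set.mem_ofPred_eq, mem_leafSet]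
    tauto
  have hdisj : Disjoint {x | T.Adj v x ∧ T.Inner x} (T.leafSet v) :=
    Set.disjoint_left.2 fun x h1 h2 => h2.2 h1.2
  rw [closedNbhd, Set.ncard_insert_of_notMem (by simp), h, Set.ncard_union_eq hdisj]

lemma IsTree.ncard_inner_le [Finite V] (hT : T.IsTree) (hT' : T'.IsTree)
    (hb : ∃ x y, 4 ≤ T.dist x y) (hb' : ∃ x y, 4 ≤ T'.dist x y)
    (hG : T.distPower 3 = T'.distPower 3) {v v' : V} (hv : Corr T T' v v') :
    {x | T.Adj v x ∧ T.Inner x}.ncard ≤ {x | T'.Adj v' x ∧ T'.Inner x}.ncard := by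
  have hex : ∀ x, ∃ x', T.Inner x → Corr T T' x x' := by
    intro x
    by_cases hx : T.Inner x
    · obtain ⟨x', h⟩ := hT.exists_corr hT' hb hb' hG hx
      exact ⟨x', fun _ => h⟩
    · exact ⟨x, fun h => absurd h hx⟩
  choose σ hσ using hex
  refine Set.ncard_le_ncard_of_injOn σ ?_ ?_
  · rintro x ⟨hx, hi⟩
    exact ⟨hT.adj_of_corr hT' hb hb' hG hv (hσ x hi) hx, (hσ x hi).symm.inner⟩
  · rintro x ⟨-, hx⟩ y ⟨-, hy⟩ h
    have := (hσ x hx).symm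
    rw [h] at this
    exact hT.corr_unique hb this (hσ y hy).symm

/-- For core vertices only the closed neighbourhoods agree as sets: which member is the centre may
differ between the trees. The leaf count follows by subtracting the centre and the inner neighbours,
whose numbers agree by injections in both directions. -/
lemma IsTree.ncard_leafSet_eq [Finite V] (hT : T.IsTree) (hT' : T'.IsTree)
    (hb : ∃ x y, 4 ≤ T.dist x y) (hb' : ∃ x y, 4 ≤ T'.dist x y)
    (hG : T.distPower 3 = T'.distPower 3) {v v' : V} (hv : Corr T T' v v') :
    (T.leafSet v).ncard = (T'.leafSet v').ncard := by
  have h1 := hT.ncard_inner_le hT' hb hb' hG hv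
  have h2 := hT'.ncard_inner_le hT hb' hb hG.symm hv.symm
  rcases hv with ⟨-, -, e⟩ | ⟨-, -, e⟩
  · have h3 := T.ncard_closedNbhd v
    rw [e, ncard_closedNbhd] at h3
    omega
  · rw [e]

/-- Trees on the same vertices with the same non-complete cube are isomorphic. -/
theorem IsTree.nonempty_iso_of_distPower_eq [Finite V] (hT : T.IsTree) (hT' : T'.IsTree)
    (hb : ∃ x y, 4 ≤ T.dist x y) (hb' : ∃ x y, 4 ≤ T'.dist x y)
    (hG : T.distPower 3 = T'.distPower 3) : Nonempty (T ≃g T') := by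
  classical
  have hex : ∀ x, ∃ x', T.Inner x → Corr T T' x x' := by
    intro x
    by_cases hx : T.Inner x
    · obtain ⟨x', h⟩ := hT.exists_corr hT' hb hb' hG hx
      exact ⟨x', fun _ => h⟩
    · exact ⟨x, fun h => absurd h hx⟩
  choose σ hσ using hex
  have hinj : ∀ x y, T.Inner x → T.Inner y → σ x = σ y → x = y := by
    intro x y hx hy h
    have := (hσ x hx).symm
    rw [h] at this
    exact hT.corr_unique hb this (hσ y hy).symm
  choose π hπ hπi using hT.1.exists_adj_inner hb
  have hleaf : ∀ v, ∃ f : V → V, T.Inner v →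
      (∀ x ∈ T.leafSet v, f x ∈ T'.leafSet (σ v)) ∧ Set.InjOn f (T.leafSet v) := by
    intro v
    by_cases hv : T.Inner v
    · have : Nonempty V := ⟨v⟩
      obtain ⟨f, hf, hfi⟩ := (Set.toFinite (T.leafSet v)).exists_injOn_of_encard_le
        (t := T'.leafSet (σ v)) (by
          rw [← (Set.toFinite _).cast_ncard_eq, ← (Set.toFinite _).cast_ncard_eq,
            hT.ncard_leafSet_eq hT' hb hb' hG (hσ v hv)])
      exact ⟨f, fun _ => ⟨fun x hx => hf hx, hfi⟩⟩
    · exact ⟨id, fun h => absurd h hv⟩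
  choose e he hei using hleaf
  have hmem : ∀ x, ¬ T.Inner x → x ∈ T.leafSet (π x) := fun x hx => ⟨(hπ x).symm, hx⟩
  -- Inner vertices follow the correspondence; a leaf x moves by the chosen injection between the
  -- leaf sets at its neighbour `π x` and at the image of that neighbour.
  let F : V → V := fun x => if T.Inner x then σ x else e (π x) x
  have hF1 : ∀ x, T.Inner x → F x = σ x := fun x hx => if_pos hx
  have hF2 : ∀ x, ¬ T.Inner x → F x = e (π x) x := fun x hx => if_neg hx
  have hFi : ∀ x, T.Inner x → T'.Inner (F x) := fun x hx => by
    rw [hF1 x hx]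
    exact (hσ x hx).symm.inner
  have hFl : ∀ x, ¬ T.Inner x → F x ∈ T'.leafSet (σ (π x)) := fun x hx => by
    rw [hF2 x hx]
    exact he (π x) (hπi x) x (hmem x hx)
  have hFinj : Function.Injective F := by
    intro x y h
    by_cases hx : T.Inner x <;> by_cases hy : T.Inner y
    · exact hinj x y hx hy (by rwa [← hF1 x hx, ← hF1 y hy])
    · exact absurd (h ▸ hFi x hx) (hFl y hy).2
    · exact absurd (h ▸ hFi y hy) (hFl x hx).2
    · have h1 := hFl x hx
      have h2 := hFl y hy
      rw [← h] at h2
      have h3 := hinj _ _ (hπi x) (hπi y) (eq_of_adj_of_not_inner h1.2 h1.1.symm h2.1.symm)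
      rw [hF2 x hx, hF2 y hy, ← h3] at h
      exact hei (π x) (hπi x) (hmem x hx) (h3 ▸ hmem y hy) h
  have hmix : ∀ a b, T.Inner a → ¬ T.Inner b → (T'.Adj (F a) (F b) ↔ T.Adj a b) := by
    intro a b ha hb
    have h1 := hFl b hb
    rw [hF1 a ha]
    constructor
    · intro h
      rw [hinj a (π b) ha (hπi b) (eq_of_adj_of_not_inner h1.2 h.symm h1.1.symm)]
      exact (hπ b).symm
    · intro h
      rw [eq_of_adj_of_not_inner hb h.symm (hπ b)]
      exact h1.1
  refine ⟨⟨Equiv.ofBijective F (Finite.injective_iff_bijective.1 hFinj), ?_⟩⟩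
  intro a b
  change T'.Adj (F a) (F b) ↔ T.Adj a b
  by_cases ha : T.Inner a <;> by_cases hb1 : T.Inner b
  · rw [hF1 a ha, hF1 b hb1]
    exact ⟨hT'.adj_of_corr hT hb' hb hG.symm (hσ a ha).symm (hσ b hb1).symm,
      hT.adj_of_corr hT' hb hb' hG (hσ a ha) (hσ b hb1)⟩
  · exact hmix a b ha hb1
  · rw [T'.adj_comm, T.adj_comm]
    exact hmix b a hb1 ha
  · have h1 := hFl a ha
    refine iff_of_false (fun h => (hFl b hb1).2 ?_) (fun h => hb1 ?_)
    · rw [eq_of_adj_of_not_inner h1.2 h h1.1.symm]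
      exact (hσ _ (hπi a)).symm.inner
    · rw [eq_of_adj_of_not_inner ha h (hπ a)]
      exact hπi a

end Correspondence

/-! ### Transport along isomorphisms, and complete cubes. -/

lemma Iso.edist_le {V W : Type*} {G : SimpleGraph V} {H : SimpleGraph W} (f : G ≃g H) (u v : V) :
    H.edist (f u) (f v) ≤ G.edist u v := by
  by_cases h : G.edist u v = ⊤
  · rw [h]; exact le_top
  · obtain ⟨p, hp⟩ := exists_walk_of_edist_ne_top h
    rw [← hp]
    have := (p.map f.toHom).edist_le
    rwa [Walk.length_map] at this

lemma Iso.edist_eq {V W : Type*} {G : SimpleGraph V} {H : SimpleGraph W} (f : G ≃g H) (u v : V) :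
    H.edist (f u) (f v) = G.edist u v := by
  refine le_antisymm (f.edist_le u v) ?_
  simpa using f.symm.edist_le (f u) (f v)

lemma distPower_comap_equiv {V W : Type*} (H : SimpleGraph W) (e : V ≃ W) (k : ℕ) :
    (H.comap e).distPower k = (H.distPower k).comap e := by
  ext u v
  change u ≠ v ∧ (H.comap e).edist u v ≤ k ↔ e u ≠ e v ∧ H.edist (e u) (e v) ≤ k
  rw [← (Iso.comap e H).edist_eq u v, e.injective.ne_iff]
  rfl

lemma nonempty_iso_completeGraph_iff {V : Type*} [Finite V] {G : SimpleGraph V} {p : ℕ} :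
    Nonempty (G ≃g completeGraph (Fin p)) ↔ Nat.card V = p ∧ ∀ x y, x ≠ y → G.Adj x y := by
  constructor
  · rintro ⟨f⟩
    exact ⟨by simpa using Nat.card_congr f.toEquiv,
      fun x y hxy => f.map_adj_iff.1 (f.injective.ne hxy)⟩
  · rintro ⟨h, hG⟩
    obtain ⟨e⟩ : Nonempty (V ≃ Fin p) := Finite.card_eq.1 (by simpa using h)
    refine ⟨⟨e, fun {a b} => ?_⟩⟩
    change e a ≠ e b ↔ G.Adj a b
    rw [e.injective.ne_iff]
    exact ⟨hG a b, Adj.ne⟩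

lemma IsTree.distPower_nonempty_iso_completeGraph_iff {V : Type*} [Finite V] {T : SimpleGraph V}
    (hT : T.IsTree) {p k : ℕ} :
    Nonempty (T.distPower k ≃g completeGraph (Fin p)) ↔
      Nat.card V = p ∧ ∀ x y, T.dist x y ≤ k := by
  rw [nonempty_iso_completeGraph_iff]
  refine and_congr_right fun _ => forall₂_congr fun x y => ?_
  rw [hT.distPower_adj]
  by_cases hxy : x = y
  · simp [hxy]
  · simp [hxy]

lemma Connected.diam_le_iff {V : Type*} [Finite V] {T : SimpleGraph V} (hT : T.Connected) {k : ℕ} :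
    T.diam ≤ k ↔ ∀ x y, T.dist x y ≤ k := by
  have := hT.nonempty
  constructor
  · exact fun h x y => (dist_le_diam (connected_iff_ediam_ne_top.1 hT)).trans h
  · intro h
    obtain ⟨x, y, hxy⟩ := T.exists_dist_eq_diam
    exact hxy ▸ h x y

/-! ### Non-isomorphic trees with complete cube. -/

/-- The graph in which every nonzero vertex `i` is joined to `f i`. -/
def parentGraph {n : ℕ} (f : Fin (n + 1) → Fin (n + 1)) : SimpleGraph (Fin (n + 1)) :=
  fromEdgeSet (Set.range fun i : Fin n => s(i.succ, f i.succ))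

lemma parentGraph_adj {n : ℕ} {f : Fin (n + 1) → Fin (n + 1)} (hf : ∀ i ≠ 0, f i < i)
    {i j : Fin (n + 1)} : (parentGraph f).Adj i j ↔ (i ≠ 0 ∧ j = f i) ∨ (j ≠ 0 ∧ i = f j) := by
  simp only [parentGraph, fromEdgeSet_adj, Set.mem_range, Sym2.eq_iff]
  constructor
  · rintro ⟨⟨k, ⟨rfl, rfl⟩ | ⟨rfl, rfl⟩⟩, -⟩
    · exact Or.inl ⟨k.succ_ne_zero, rfl⟩
    · exact Or.inr ⟨k.succ_ne_zero, rfl⟩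
  · rintro (⟨h, rfl⟩ | ⟨h, rfl⟩)
    · obtain ⟨k, rfl⟩ := Fin.exists_succ_eq.2 h
      exact ⟨⟨k, Or.inl ⟨rfl, rfl⟩⟩, (hf _ h).ne'⟩
    · obtain ⟨k, rfl⟩ := Fin.exists_succ_eq.2 h
      exact ⟨⟨k, Or.inr ⟨rfl, rfl⟩⟩, (hf _ h).ne⟩

lemma parentGraph_adj_parent {n : ℕ} {f : Fin (n + 1) → Fin (n + 1)} (hf : ∀ i ≠ 0, f i < i)
    {i : Fin (n + 1)} (hi : i ≠ 0) : (parentGraph f).Adj i (f i) :=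
  (parentGraph_adj hf).2 (Or.inl ⟨hi, rfl⟩)

/-- Iterating `f` descends to 0, so the graph is connected, and it has at most n edges on n + 1
vertices. -/
lemma parentGraph_isTree {n : ℕ} {f : Fin (n + 1) → Fin (n + 1)} (hf : ∀ i ≠ 0, f i < i) :
    (parentGraph f).IsTree := by
  have hreach : ∀ i, (parentGraph f).Reachable i 0 := by
    intro i
    induction i using WellFoundedLT.induction with
    | ind i ih =>
      by_cases hi : i = 0
      · rw [hi]
      · exact (parentGraph_adj_parent hf hi).reachable.trans (ih _ (hf i hi))
  have hconn : (parentGraph f).Connected :=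
    { preconnected := fun i j => (hreach i).trans (hreach j).symm
      nonempty := ⟨0⟩ }
  refine isTree_iff_connected_and_card.2 ⟨hconn, le_antisymm ?_ ?_⟩
  · have h1 : (parentGraph f).edgeSet ⊆ Set.range fun i : Fin n => s(i.succ, f i.succ) := by
      rw [parentGraph, edgeSet_fromEdgeSet]
      exact Set.sdiff_subset
    have h2 := Set.ncard_le_ncard h1
    have h3 : (Set.range fun i : Fin n => s(i.succ, f i.succ)).ncard ≤ n := by
      rw [← Nat.card_coe_set_eq]
      exact (Finite.card_range_le _).trans (Nat.card_fin n).le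
    rw [Nat.card_coe_set_eq, Nat.card_fin]
    omega
  · exact hconn.card_vert_le_card_edgeSet_add_one

lemma dist_le_three_of_parentGraph {n : ℕ} {f : Fin (n + 1) → Fin (n + 1)}
    (hf : ∀ i ≠ 0, f i < i) (c : Fin (n + 1)) (hc : c ≠ 0) (hfc : f (f c) = 0)
    (h0 : ∀ i ≠ c, f i = 0) (i j : Fin (n + 1)) : (parentGraph f).dist i j ≤ 3 := by
  have hT := parentGraph_isTree hf
  have h1 : ∀ i ≠ c, (parentGraph f).dist i 0 ≤ 1 := by
    intro i hi
    by_cases h : i = 0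
    · simp [h]
    · have := parentGraph_adj_parent hf h
      rw [h0 i hi] at this
      exact (dist_eq_one_iff_adj.2 this).le
  have h2 : (parentGraph f).dist c 0 ≤ 2 := by
    have h3 := dist_eq_one_iff_adj.2 (parentGraph_adj_parent hf hc)
    have h4 := h1 (f c) (hf c hc).ne
    have := hT.1.dist_triangle (u := c) (v := f c) (w := 0)
    omega
  have h3 := hT.1.dist_triangle (u := i) (v := 0) (w := j)
  rw [dist_comm (u := 0)] at h3
  by_cases hi : i = c
  · by_cases hj : j = c
    · simp [hi, hj]
    · have := h1 j hj
      subst hi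
      omega
  · by_cases hj : j = c
    · have := h1 i hi
      subst hj
      omega
    · have := h1 i hi
      have := h1 j hj
      omega

lemma exists_not_iso_trees_of_dist_le_three {p : ℕ} (hp : 4 ≤ p) :
    ∃ T₁ T₂ : SimpleGraph (Fin p), T₁.IsTree ∧ T₂.IsTree ∧ (∀ x y, T₁.dist x y ≤ 3) ∧
      (∀ x y, T₂.dist x y ≤ 3) ∧ ¬ Nonempty (T₁ ≃g T₂) := by
  obtain ⟨n, rfl⟩ : ∃ n, p = n + 3 + 1 := ⟨p - 4, by omega⟩
  -- `f` gives the star centred at 0, and `g` re-hangs vertex 3 on vertex 1. Vertex 2 serves as a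
  -- non-neighbour of 1, so the second tree has no vertex adjacent to all others.
  let one : Fin (n + 3 + 1) := ⟨1, by omega⟩
  let two : Fin (n + 3 + 1) := ⟨2, by omega⟩
  let c : Fin (n + 3 + 1) := ⟨3, by omega⟩
  let f : Fin (n + 3 + 1) → Fin (n + 3 + 1) := fun _ => 0
  let g : Fin (n + 3 + 1) → Fin (n + 3 + 1) := fun i => if i = c then one else 0
  have hc : c ≠ 0 := by simp [c, Fin.ext_iff]
  have hone : one ≠ c := by simp [c, one]
  have hgc : g c = one := if_pos rfl
  have hg0 : ∀ i ≠ c, g i = 0 := fun i hi => if_neg hi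
  have hf : ∀ i ≠ 0, f i < i := fun i hi => Fin.pos_iff_ne_zero.2 hi
  have hg : ∀ i ≠ 0, g i < i := by
    intro i hi
    by_cases h : i = c
    · rw [h, hgc]; simp [c, one, Fin.lt_def]
    · rw [hg0 i h]; exact Fin.pos_iff_ne_zero.2 hi
  refine ⟨parentGraph f, parentGraph g, parentGraph_isTree hf, parentGraph_isTree hg,
    dist_le_three_of_parentGraph hf c hc rfl fun _ _ => rfl,
    dist_le_three_of_parentGraph hg c hc (by rw [hgc, hg0 one hone]) hg0, ?_⟩
  rintro ⟨φ⟩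
  have huniv : ∀ y, φ 0 ≠ y → (parentGraph g).Adj (φ 0) y := by
    intro y hy
    obtain ⟨x, rfl⟩ := φ.surjective y
    rw [φ.map_adj_iff, parentGraph_adj hf]
    exact Or.inr ⟨fun h => hy (h ▸ rfl), rfl⟩
  have hno : ∀ a, ∃ y, a ≠ y ∧ ¬ (parentGraph g).Adj a y := by
    intro a
    simp only [parentGraph_adj hg, g]
    by_cases h0 : a = 0
    · exact ⟨c, by subst h0; simp [c, one, Fin.ext_iff]⟩
    · by_cases h1 : a = one
      · exact ⟨two, by subst h1; simp [c, one, two, Fin.ext_iff]⟩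
      · by_cases h3 : a = c
        · exact ⟨0, by subst h3; simp [c, one, Fin.ext_iff]⟩
        · exact ⟨one, h1, by simp [h3, h0, hone]; simp [one]⟩
  obtain ⟨y, hy, hn⟩ := hno (φ 0)
  exact hn (huniv y hy)

end SimpleGraph

theorem theorem3p2 :
    -- uniqueness of the tree cube root when the cube is not a complete graph
    (∀ (V : Type u) (W : Type v) [Finite V] [Finite W]
      (T : SimpleGraph V) (T' : SimpleGraph W), T.IsTree → T'.IsTree →
      (∀ p : ℕ, ¬ Nonempty (T.distPower 3 ≃g SimpleGraph.completeGraph (Fin p))) →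
      Nonempty (T.distPower 3 ≃g T'.distPower 3) → Nonempty (T ≃g T')) ∧
    -- the tree cube roots of `K_p` are exactly the `p`-vertex trees of diameter less than `4`
    (∀ (V : Type u) [Finite V] (T : SimpleGraph V), T.IsTree → ∀ p : ℕ,
      (Nonempty (T.distPower 3 ≃g SimpleGraph.completeGraph (Fin p)) ↔ Nat.card V = p ∧ T.diam < 4)) ∧
    -- and uniqueness fails for them
    (∀ p : ℕ, 4 ≤ p → ∃ T₁ T₂ : SimpleGraph (Fin p), T₁.IsTree ∧ T₂.IsTree ∧
      Nonempty (T₁.distPower 3 ≃g SimpleGraph.completeGraph (Fin p)) ∧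
      Nonempty (T₂.distPower 3 ≃g SimpleGraph.completeGraph (Fin p)) ∧
      ¬ Nonempty (T₁ ≃g T₂)) := by
  refine ⟨?_, ?_, ?_⟩
  · rintro V W _ _ T T' hT hT' hK ⟨φ⟩
    -- Pulling T' back along the bijection puts both trees on one vertex set, where their cubes are
    -- equal and not merely isomorphic.
    have hcomap : T.distPower 3 = (T'.comap φ.toEquiv).distPower 3 := by
      rw [SimpleGraph.distPower_comap_equiv]
      ext u v
      exact φ.map_adj_iff.symm
    have ψ := SimpleGraph.Iso.comap φ.toEquiv T'
    have hS : (T'.comap φ.toEquiv).IsTree := ψ.isTree_iff.2 hT'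
    have hfar : ∀ {S : SimpleGraph V}, S.IsTree → S.distPower 3 = T.distPower 3 →
        ∃ x y, 4 ≤ S.dist x y := by
      intro S hS hST
      by_contra! h
      refine hK (Nat.card V) ?_
      rw [← hST]
      exact hS.distPower_nonempty_iso_completeGraph_iff.2
        ⟨rfl, fun x y => Nat.le_of_lt_succ (h x y)⟩
    obtain ⟨e⟩ := hT.nonempty_iso_of_distPower_eq hS (hfar hT rfl) (hfar hS hcomap.symm) hcomap
    exact ⟨e.trans ψ⟩
  · intro V _ T hT p
    rw [hT.distPower_nonempty_iso_completeGraph_iff, ← hT.1.diam_le_iff, Nat.lt_succ_iff]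
  · intro p hp
    obtain ⟨T₁, T₂, h₁, h₂, hd₁, hd₂, hn⟩ :=
      SimpleGraph.exists_not_iso_trees_of_dist_le_three hp
    exact ⟨T₁, T₂, h₁, h₂,
      h₁.distPower_nonempty_iso_completeGraph_iff.2 ⟨Nat.card_fin p, hd₁⟩,
      h₂.distPower_nonempty_iso_completeGraph_iff.2 ⟨Nat.card_fin p, hd₂⟩, hn⟩
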